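/- Let $p$ be a prime. Consider the grid $\mathbb{Z}\times\mathbb{Z}$ of squares, each having a state in $\mathbb{Z}/p\mathbb{Z}$, initially $0$; a click in a square adds $1$ to the state of that square and of each of the four horizontally or vertically adjacent squares. A pattern of clicks is a finitely supported function $c:\mathbb{Z}\times\mathbb{Z}\to\mathbb{Z}/p\mathbb{Z}$, where $c(i,j)$ is the number of clicks modulo $p$ in the square $(i,j)$; it is identified with the Laurent polynomial $\sum_{i,j} c(i,j)x^iy^j$ over $\mathbb{Z}/p\mathbb{Z}$. Let $g(x,y)=x+y+1+x^{-1}+y^{-1}$. The evolution of the pattern $f(x,y)$ is the pattern $\mathrm{Evo}_p(f)=f(x^p,y^p)\,g(x,y)^{p-1}$, and for $n\ge 0$ and $k_0\in\mathbb{Z}/p\mathbb{Z}$ let $\mathrm{Evo}_p^{(n)}(k_0)$ be the result of applying $\mathrm{Evo}_p$ $n$ times to the constant $k_0$ (so that $\mathrm{Evo}_p^{(0)}(k_0)$ is the square $(0,0)$ clicked $k_0$ times). For every nonzero pattern of clicks $c$, the number of squares with nonzero state after the clicks $c$ is finite and at least five. It equals five if and only if $c$ is a translate of $\mathrm{Evo}_p^{(n)}(k_0)$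 for some $n\ge 0$ and some nonzero $k_0\in\mathbb{Z}/p\mathbb{Z}$. -/

import Mathlib

namespace LightsOut

/-- A square of the grid that is infinite in all four directions. -/
abbrev Square := ℤ × ℤ

/-- The result of finitely many clicks modulo `k`: the number of times each square was clicked,
modulo `k`, zero outside a finite set of squares. -/
abbrev Clicks (k : ℕ) := Square →₀ ZMod k

/-- The state of the square `q` after the clicks `c`, all squares starting in state `0`.
A click in a square adds `1` to the state of that square and of each of the four squares
horizontally or vertically adjacent to it. -/
def state {k : ℕ} (c : Clicks k) (q : Square) : ZMod k :=
  c q + c (q + (1, 0)) + c (q + (-1, 0)) + c (q + (0, 1)) + c (q + (0, -1))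

/-- The squares that are lit (have nonzero state) after the clicks `c`. -/
def lit {k : ℕ} (c : Clicks k) : Set Square :=
  {q | state c q ≠ 0}

/-- Laurent polynomials in two variables `x`, `y` over `ℤ/kℤ`; the monomial `x ^ i * y ^ j` is
`AddMonoidAlgebra.single (i, j) 1`. -/
abbrev Laurent (k : ℕ) := AddMonoidAlgebra (ZMod k) Square

/-- The Laurent polynomial `g = x + y + 1 + x⁻¹ + y⁻¹`. -/
noncomputable def g (k : ℕ) : Laurent k :=
  AddMonoidAlgebra.single (1, 0) 1 + AddMonoidAlgebra.single (0, 1) 1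
    + AddMonoidAlgebra.single (0, 0) 1
    + AddMonoidAlgebra.single (-1, 0) 1 + AddMonoidAlgebra.single (0, -1) 1

/-- Evolution of patterns, `f(x, y) ↦ f(x ^ p, y ^ p) * g(x, y) ^ (p - 1)`. -/
noncomputable def evo (p : ℕ) (f : Laurent p) : Laurent p :=
  AddMonoidAlgebra.mapDomain (fun q : Square => ((p : ℤ) * q.1, (p : ℤ) * q.2)) f
    * g p ^ (p - 1)

/-- The `n`-fold evolution of a single square carrying the number `k₀`, centred at `(0, 0)`:
the number of clicks in square `(i, j)` is the coefficient of `x ^ i * y ^ j`. -/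
noncomputable def evoPattern (p n : ℕ) (k₀ : ZMod p) : Clicks p :=
  ((evo p)^[n] (AddMonoidAlgebra.single (0, 0) k₀)).coeff

end LightsOut

/-!
The state after the clicks `c` is the Laurent polynomial `c * g`, so the question is which multiples
of `g` have few terms. The `n`-th evolution of a square is `k₀ * g ^ (p ^ n - 1)`, and `g ^ p ^ n` has
five terms by Frobenius; it has to be shown that a nonzero multiple `f` of `g` with at most five
terms is a monomial times some `g ^ p ^ n`.

Such an `f` vanishes at every point of the curve `g = 0`, in any field. Let `U = -x * y` and
`V = -x / y`, so that `(1 - U) * (1 - V) = x * (g - 1)`. The curve has four points at infinity,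
permuted by the symmetries `x ↔ y`, `x ↦ x⁻¹`, `y ↦ y⁻¹`; at one of them `x`, `1 - U`, `V` have
orders `1`, `1`, `2`, and it is given by explicit Laurent series (`exists_isPlace`). The order of
`x ^ i * y ^ j` at the four points is `±(i + j)`, `±(i - j)`, so the vanishing of `f` forces two terms
on each side of the bounding box of its support with diagonal sides
(`exists_ne_of_sum_eq_zero`). Hence (`hasRectangle_or_hasPentagon`) the support contains all four
corners of the box, or it consists of three corners and a point on each of the two sides through the
fourth one.

The residues at infinity determine the coefficients up to a scalar. The orders of the resulting
relation are then computed from `ord_one_sub_pow`: the order of `1 - U ^ m` is the `p`-part `N(m)`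
of `m`.
* Four corners (`rectangle_relation`): `a * (1 - U ^ m) * (1 - V ^ n) = -ε * x ^ k * y ^ l` gives
  `N(m) = k - l = 2 * n - (k - l)` and `N(n) = k + l = 2 * m - (k + l)`, hence `m = n = k = p ^ r`
  and `l = 0`, and the left hand side is `a * x ^ k * (g - 1) ^ k = a * x ^ k * (g ^ k - 1)`.
* Three corners (`pentagon_relation`):
  `1 - U ^ m - V ^ n + U ^ m * V ^ n' + V ^ n * U ^ m' = 0` gives `N(m) = 2 * n'`, `N(n) = 2 * m'`,
  `N(n') = 2 * (m - m')`, `N(m') = 2 * (n - n')`, which contradicts `N(k) ≤ k`.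
-/

namespace LightsOut

/-! ### Orders and residues -/

section Valuation

variable {K : Type*} [Field K] {v : AddValuation K (WithTop ℤ)}

theorem ord_mul {x y : K} {m n : ℤ} (hx : v x = (m : WithTop ℤ)) (hy : v y = (n : WithTop ℤ)) :
    v (x * y) = ((m + n : ℤ) : WithTop ℤ) := by
  rw [v.map_mul, hx, hy, WithTop.coe_add]

theorem ord_inv {x : K} {m : ℤ} (hx : v x = (m : WithTop ℤ)) :
    v x⁻¹ = ((-m : ℤ) : WithTop ℤ) := by
  rw [v.map_inv, hx]; rfl

theorem ord_pow {x : K} {m : ℤ} (hx : v x = (m : WithTop ℤ)) (n : ℕ) :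
    v (x ^ n) = ((n * m : ℤ) : WithTop ℤ) := by
  rw [v.map_pow, hx, ← WithTop.coe_nsmul, nsmul_eq_mul]

theorem ord_zpow {x : K} {m : ℤ} (hx : v x = (m : WithTop ℤ)) (n : ℤ) :
    v (x ^ n) = ((n * m : ℤ) : WithTop ℤ) := by
  obtain ⟨k, rfl | rfl⟩ := n.eq_nat_or_neg
  · simpa using ord_pow hx k
  · rw [zpow_neg, zpow_natCast, ord_inv (ord_pow hx k), neg_mul]

theorem ne_zero_of_ord {x : K} {m : ℤ} (hx : v x = (m : WithTop ℤ)) : x ≠ 0 := by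
  rintro rfl
  simp at hx

theorem ord_unique {x : K} {m n : ℤ} (hx : v x = (m : WithTop ℤ)) (hy : v x = (n : WithTop ℤ)) :
    m = n := by
  rw [hx] at hy; exact_mod_cast hy

theorem ord_add_of_lt {x y : K} {m n : ℤ} (hx : v x = (m : WithTop ℤ))
    (hy : v y = (n : WithTop ℤ)) (h : m < n) : v (x + y) = (m : WithTop ℤ) := by
  rw [v.map_add_eq_of_lt_left, hx]
  rw [hx, hy]; exact_mod_cast h

variable {F : Type*} [Field F] [Algebra F K]

/-- `x` is integral at the place `v` with residue the constant `a`. -/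
def HasResidue (v : AddValuation K (WithTop ℤ)) (x : K) (a : F) : Prop :=
  0 < v (x - algebraMap F K a)

/-- Nonzero constants are units at the place `v`. -/
def TrivialOn (F : Type*) [Field F] [Algebra F K] (v : AddValuation K (WithTop ℤ)) : Prop :=
  ∀ a : F, a ≠ 0 → v (algebraMap F K a) = ((0 : ℤ) : WithTop ℤ)

theorem TrivialOn.nonneg (hv : TrivialOn F v) (a : F) : 0 ≤ v (algebraMap F K a) := by
  by_cases ha : a = 0
  · simp [ha]
  · rw [hv a ha]; rfl

theorem HasResidue.nonneg (hv : TrivialOn F v) {x : K} {a : F} (hx : HasResidue v x a) :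
    0 ≤ v x := by
  have := v.map_le_add hx.le (hv.nonneg a)
  simpa using this

theorem hasResidue_algebraMap (a : F) : HasResidue v (algebraMap F K a) a := by
  simp [HasResidue]

theorem HasResidue.add {x y : K} {a b : F} (hx : HasResidue v x a) (hy : HasResidue v y b) :
    HasResidue v (x + y) (a + b) := by
  have := v.map_lt_add hx hy
  rw [HasResidue, map_add]
  convert this using 2
  ring

theorem HasResidue.mul (hv : TrivialOn F v) {x y : K} {a b : F} (hx : HasResidue v x a)
    (hy : HasResidue v y b) : HasResidue v (x * y) (a * b) := by
  have h1 : 0 < v ((x - algebraMap F K a) * y) := by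
    rw [v.map_mul]
    exact hx.trans_le (le_add_of_nonneg_right (hy.nonneg hv))
  have h2 : 0 < v (algebraMap F K a * (y - algebraMap F K b)) := by
    rw [v.map_mul]
    exact lt_of_lt_of_le hy (le_add_of_nonneg_left (hv.nonneg a))
  have := v.map_lt_add h1 h2
  rw [HasResidue, map_mul]
  convert this using 2
  ring

theorem HasResidue.pow_one (hv : TrivialOn F v) {x : K} (hx : HasResidue v x (1 : F)) (n : ℕ) :
    HasResidue v (x ^ n) (1 : F) := by
  induction n with
  | zero => simpa using hasResidue_algebraMap (v := v) (1 : F)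
  | succ n ih => simpa [pow_succ] using ih.mul hv hx

theorem hasResidue_zero_of_ord {x : K} {m : ℤ} (hx : v x = (m : WithTop ℤ)) (hm : 0 < m) :
    HasResidue v x (0 : F) := by
  rw [HasResidue, map_zero, sub_zero, hx]; exact_mod_cast hm

theorem HasResidue.eq_zero (hv : TrivialOn F v) {a : F} (h : HasResidue v 0 a) : a = 0 := by
  by_contra ha
  rw [HasResidue, zero_sub, v.map_neg, hv a ha] at h
  exact lt_irrefl _ h

theorem HasResidue.ord (hv : TrivialOn F v) {x : K} {a : F} (h : HasResidue v x a) (ha : a ≠ 0) :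
    v x = ((0 : ℤ) : WithTop ℤ) := by
  have h1 : v (algebraMap F K a) < v (x - algebraMap F K a) := by rw [hv a ha]; exact h
  rw [v.map_eq_of_lt_sub h1, hv a ha]

end Valuation

section Place

variable {p : ℕ} [Fact p.Prime] {K : Type*} [Field K] [Algebra (ZMod p) K]
  {v : AddValuation K (WithTop ℤ)}

/-- In characteristic `p`, for `x` with `1 - x` a uniformizer, only the `p`-part of `m` contributes
to the order of `1 - x ^ m`, since the other roots of unity have residue different from `1`. -/
theorem ord_one_sub_pow (hv : TrivialOn (ZMod p) v) {x : K}
    (hx : v (1 - x) = ((1 : ℤ) : WithTop ℤ)) {m : ℕ} (hm : m ≠ 0) :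
    v (1 - x ^ m) = (((p ^ padicValNat p m : ℕ) : ℤ) : WithTop ℤ) := by
  obtain ⟨r, hr⟩ := pow_padicValNat_dvd (p := p) (n := m)
  have hpr : ¬ p ∣ r := by
    rintro ⟨s, rfl⟩
    apply pow_succ_padicValNat_not_dvd (p := p) hm
    exact ⟨s, by rw [pow_succ]; linarith⟩
  have : CharP K p := charP_of_injective_algebraMap (algebraMap (ZMod p) K).injective p
  have hx1 : HasResidue v x (1 : ZMod p) := by
    rw [HasResidue, map_one, v.map_sub_swap, hx]; exact_mod_cast one_pos
  have hsum : ∀ k : ℕ, HasResidue v (∑ i ∈ Finset.range k, x ^ i) (k : ZMod p) := by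
    intro k
    induction k with
    | zero => simpa using hasResidue_algebraMap (v := v) (0 : ZMod p)
    | succ k ih =>
      rw [Finset.sum_range_succ, Nat.cast_succ]
      exact ih.add (hx1.pow_one hv k)
  have hr0 : (r : ZMod p) ≠ 0 := by rwa [Ne, ZMod.natCast_eq_zero_iff]
  have h1 : v (1 - x ^ r) = ((1 : ℤ) : WithTop ℤ) := by
    rw [← mul_neg_geom_sum]
    simpa using ord_mul hx ((hsum r).ord hv hr0)
  have h2 : 1 - x ^ m = (1 - x ^ r) ^ p ^ padicValNat p m := by
    rw [sub_pow_char_pow, one_pow, ← pow_mul, mul_comm r, ← hr]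
  rw [h2]
  simpa using ord_pow h1 (p ^ padicValNat p m)

end Place

/-! ### The curve and its points at infinity -/

/-- `(X, Y)` is a point with nonzero coordinates of the curve `x + y + 1 + x⁻¹ + y⁻¹ = 0`. -/
structure OnCurve {K : Type*} [Field K] (X Y : K) : Prop where
  left_ne_zero : X ≠ 0
  right_ne_zero : Y ≠ 0
  eq_zero : X + Y + 1 + X⁻¹ + Y⁻¹ = 0

namespace OnCurve

variable {K : Type*} [Field K] {X Y : K}

theorem swap (h : OnCurve X Y) : OnCurve Y X :=
  ⟨h.2, h.1, by linear_combination h.3⟩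

theorem inv_right (h : OnCurve X Y) : OnCurve X Y⁻¹ :=
  ⟨h.1, inv_ne_zero h.2, by rw [inv_inv]; linear_combination h.3⟩

theorem inv_left (h : OnCurve X Y) : OnCurve X⁻¹ Y := h.swap.inv_right.swap

end OnCurve

/-- `v` is trivial on constants, and `(X, Y)` is a point of the curve `g = 0` whose behaviour
at the place `v` is that near the point at infinity where `x = 0`, `y = ∞` and `x * y = -1`. -/
structure IsPlace (p : ℕ) [Fact p.Prime] {K : Type*} [Field K] [Algebra (ZMod p) K]
    (v : AddValuation K (WithTop ℤ)) (X Y : K) : Prop where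
  trivialOn : TrivialOn (ZMod p) v
  onCurve : OnCurve X Y
  ord_left : v X = ((1 : ℤ) : WithTop ℤ)
  ord_one_add : v (1 + X * Y) = ((1 : ℤ) : WithTop ℤ)

open PowerSeries in
/-- The equation of the curve in the local coordinate `X` at infinity, with `y = (X * w - 1) / X`,
has a power series solution by Hensel's lemma. -/
theorem exists_powerSeries_root (F : Type*) [Field F] :
    ∃ w : PowerSeries F, IsUnit w ∧ w * (X * w - (1 - X - X ^ 2)) = 1 := by
  let a : PowerSeries F := 1 - X - X ^ 2
  have ha : IsUnit a := by
    rw [PowerSeries.isUnit_iff_constantCoeff]; simp [a]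
  let f : Polynomial (PowerSeries F) :=
    Polynomial.X ^ 2 + (Polynomial.C (-a) * Polynomial.X + Polynomial.C (-X))
  have hf : f.Monic := by
    apply Polynomial.monic_X_pow_add
    refine lt_of_le_of_lt (Polynomial.degree_linear_le) (by norm_num)
  obtain ⟨z, hz, hz0⟩ := HenselianRing.is_henselian (I := Ideal.span {(X : PowerSeries F)}) f hf 0
    (by simp [f]) (by
      apply IsUnit.map
      simpa [f] using ha)
  rw [sub_zero, Ideal.mem_span_singleton] at hz0
  obtain ⟨w, rfl⟩ := hz0
  have h1 : w * (X * w - (1 - X - X ^ 2)) = 1 := by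
    have h2 : (X : PowerSeries F) * (w * (X * w - (1 - X - X ^ 2))) = X * 1 := by
      simp [f, a] at hz
      linear_combination hz
    exact mul_left_cancel₀ PowerSeries.X_ne_zero h2
  exact ⟨w, IsUnit.of_mul_eq_one _ h1, h1⟩

/-- The point at infinity where `x = 0`, `y = ∞` is realized by Laurent series in `x`. -/
theorem exists_isPlace (p : ℕ) [Fact p.Prime] :
    ∃ X Y : LaurentSeries (ZMod p),
      IsPlace p (HahnSeries.addVal ℤ (ZMod p)) X Y := by
  obtain ⟨w, hw, h⟩ := exists_powerSeries_root (ZMod p)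
  let ι := HahnSeries.ofPowerSeries ℤ (ZMod p)
  set v := HahnSeries.addVal ℤ (ZMod p) with hv
  have hnn : ∀ f : PowerSeries (ZMod p), 0 ≤ v (ι f) := by
    intro f
    rw [HahnSeries.addVal_apply, ← WithTop.coe_zero, HahnSeries.le_orderTop_iff_forall]
    intro i hi
    rw [HahnSeries.ofPowerSeries_apply, HahnSeries.embDomain_of_notMem_range]
    rintro ⟨k, rfl⟩
    have : (k : ℤ) < 0 := WithTop.coe_lt_coe.mp hi
    lia
  have hunit : ∀ f : PowerSeries (ZMod p), IsUnit f → v (ι f) = 0 := by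
    rintro _ ⟨u, rfl⟩
    have h1 : v (ι u) + v (ι (u⁻¹ : (PowerSeries (ZMod p))ˣ)) = 0 := by
      rw [← v.map_mul, ← map_mul, Units.mul_inv, map_one, v.map_one]
    have h2 := hnn u
    have h3 := hnn (u⁻¹ : (PowerSeries (ZMod p))ˣ)
    exact le_antisymm (by rw [← h1]; exact le_add_of_nonneg_right h3) h2
  have hX : v (ι PowerSeries.X) = ((1 : ℤ) : WithTop ℤ) := by
    rw [HahnSeries.ofPowerSeries_X, HahnSeries.addVal_apply, HahnSeries.orderTop_single one_ne_zero]
  have hX0 : ι PowerSeries.X ≠ 0 := ne_zero_of_ord hX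
  have hh : ι w * (ι PowerSeries.X * ι w - (1 - ι PowerSeries.X - ι PowerSeries.X ^ 2)) = 1 := by
    have := congrArg ι h
    simpa only [map_mul, map_sub, map_pow, map_one] using this
  have hXw : v (ι PowerSeries.X * ι w) = ((1 : ℤ) : WithTop ℤ) := by
    simpa using ord_mul hX (hunit w hw)
  have hY0 : ι PowerSeries.X * ι w - 1 ≠ 0 := by
    intro h0
    rw [sub_eq_zero.mp h0, v.map_one] at hXw
    exact absurd hXw (by decide)
  refine ⟨ι PowerSeries.X, (ι PowerSeries.X * ι w - 1) / ι PowerSeries.X, ?_, ⟨hX0, ?_, ?_⟩, hX, ?_⟩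
  · intro a ha
    rw [Subsingleton.elim (algebraMap (ZMod p) (LaurentSeries (ZMod p))) HahnSeries.C,
      HahnSeries.addVal_apply]
    exact HahnSeries.orderTop_single ha
  · exact div_ne_zero hY0 hX0
  · field_simp
    linear_combination (ι PowerSeries.X) * hh
  · rw [mul_div_cancel₀ _ hX0, add_sub_cancel]
    exact hXw

/-! ### Relations between monomials at the points at infinity -/

section PlaceAtInfinity

variable {p : ℕ} [Fact p.Prime] {K : Type*} [Field K] [Algebra (ZMod p) K]
  {v : AddValuation K (WithTop ℤ)}

namespace IsPlace

variable {X Y : K}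

theorem ord_one_sub (h : IsPlace p v X Y) : v (1 - -(X * Y)) = ((1 : ℤ) : WithTop ℤ) := by
  rw [sub_neg_eq_add, h.ord_one_add]

theorem hasResidue_one (h : IsPlace p v X Y) : HasResidue v (-(X * Y)) (1 : ZMod p) := by
  rw [HasResidue, map_one, v.map_sub_swap, h.ord_one_sub]; exact_mod_cast one_pos

theorem ord_right (h : IsPlace p v X Y) : v Y = ((-1 : ℤ) : WithTop ℤ) := by
  have h1 := h.hasResidue_one.ord h.trivialOn one_ne_zero
  rw [v.map_neg] at h1
  have h2 := ord_mul h1 (ord_inv h.ord_left)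
  rwa [mul_comm X, mul_inv_cancel_right₀ h.onCurve.left_ne_zero] at h2

theorem ord_neg_div (h : IsPlace p v X Y) : v (-(X * Y⁻¹)) = ((2 : ℤ) : WithTop ℤ) := by
  rw [v.map_neg]
  exact ord_mul h.ord_left (ord_inv h.ord_right)

end IsPlace

theorem ord_one_sub_of_pos {x : K} {m : ℤ} (hx : v x = (m : WithTop ℤ)) (hm : 0 < m) :
    v (1 - x) = ((0 : ℤ) : WithTop ℤ) := by
  rw [sub_eq_add_neg]
  refine ord_add_of_lt (n := m) (by rw [v.map_one]; rfl) (by rw [v.map_neg, hx]) hm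

/-- A nonempty sum of monomials in `X`, `Y` with nonzero constant coefficients which is zero attains
its least order at least twice. -/
theorem exists_ne_of_sum_eq_zero (hv : TrivialOn (ZMod p) v) {X Y : K} {α β : ℤ}
    (hX : v X = (α : WithTop ℤ)) (hY : v Y = (β : WithTop ℤ)) (c : Square →₀ ZMod p)
    (h0 : c.sum (fun q a => algebraMap (ZMod p) K a * (X ^ q.1 * Y ^ q.2)) = 0)
    {q : Square} (hq : q ∈ c.support)
    (hmin : ∀ r ∈ c.support, α * q.1 + β * q.2 ≤ α * r.1 + β * r.2) :
    ∃ r ∈ c.support, r ≠ q ∧ α * r.1 + β * r.2 = α * q.1 + β * q.2 := by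
  by_contra! hcon
  have hord : ∀ r ∈ c.support, v (algebraMap (ZMod p) K (c r) * (X ^ r.1 * Y ^ r.2)) =
      ((α * r.1 + β * r.2 : ℤ) : WithTop ℤ) := by
    intro r hr
    rw [ord_mul (hv _ (Finsupp.mem_support_iff.mp hr)) (ord_mul (ord_zpow hX _) (ord_zpow hY _))]
    congr 1
    ring
  rw [Finsupp.sum, ← Finset.add_sum_erase _ _ hq] at h0
  have h1 : ((α * q.1 + β * q.2 : ℤ) : WithTop ℤ) < v (∑ r ∈ c.support.erase q,
      algebraMap (ZMod p) K (c r) * (X ^ r.1 * Y ^ r.2)) := by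
    refine v.map_lt_sum WithTop.coe_ne_top fun r hr => ?_
    obtain ⟨hrq, hr⟩ := Finset.mem_erase.mp hr
    rw [hord r hr]
    exact WithTop.coe_lt_coe.mpr (lt_of_le_of_ne (hmin r hr) (hcon r hr hrq).symm)
  rw [← hord q hq] at h1
  have h2 := v.map_add_eq_of_lt_left h1
  rw [h0, v.map_zero, hord q hq] at h2
  exact WithTop.top_ne_coe h2

end PlaceAtInfinity

/-! ### Relations supported on rectangles and pentagons -/

section Polygons

variable {p : ℕ} [Fact p.Prime] {K : Type*} [Field K] [Algebra (ZMod p) K]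
  {v : AddValuation K (WithTop ℤ)}

/-- If a relation has only two terms on an edge, their coefficients cancel. -/
theorem add_eq_zero_of_edge (hv : TrivialOn (ZMod p) v) {P R : K}
    (hP : HasResidue v P (1 : ZMod p)) {a b : ZMod p} {m : ℕ} (hR : HasResidue v R (0 : ZMod p))
    (h : algebraMap (ZMod p) K a + algebraMap (ZMod p) K b * P ^ m + R = 0) : a + b = 0 := by
  have := ((hasResidue_algebraMap a).add
    ((hasResidue_algebraMap b).mul hv (hP.pow_one hv m))).add hR
  rw [h] at this
  simpa using this.eq_zero hv

/-- In a relation between the corners of a rectangle and a monomial `T` off the edge `1`, `P ^ m`,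
the coefficients on this edge cancel. -/
theorem add_eq_zero_of_rectangle (hv : TrivialOn (ZMod p) v) {P Q T : K}
    (hP : HasResidue v P (1 : ZMod p)) (hQ : v Q = ((2 : ℤ) : WithTop ℤ)) {j : ℤ}
    (hT : v T = (j : WithTop ℤ)) {a b c d e : ZMod p} {m n : ℕ} (hn : 0 < n) (hj : e = 0 ∨ 0 < j)
    (h : algebraMap (ZMod p) K a + algebraMap (ZMod p) K b * P ^ m
      + algebraMap (ZMod p) K c * Q ^ n + algebraMap (ZMod p) K d * (P ^ m * Q ^ n)
      + algebraMap (ZMod p) K e * T = 0) : a + b = 0 := by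
  have hC : ∀ x : ZMod p, HasResidue v (algebraMap (ZMod p) K x) x := hasResidue_algebraMap
  have hQn : HasResidue v (Q ^ n) (0 : ZMod p) := hasResidue_zero_of_ord (ord_pow hQ n) (by lia)
  have hT' : HasResidue v (algebraMap (ZMod p) K e * T) (0 : ZMod p) := by
    rcases hj with rfl | hj
    · simpa using hC 0
    · simpa using (hC e).mul hv (hasResidue_zero_of_ord hT hj)
  refine add_eq_zero_of_edge (R := algebraMap (ZMod p) K c * Q ^ n
    + algebraMap (ZMod p) K d * (P ^ m * Q ^ n) + algebraMap (ZMod p) K e * T) hv hP (m := m) ?_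
    (by linear_combination h)
  simpa using (((hC c).mul hv hQn).add ((hC d).mul hv ((hP.pow_one hv m).mul hv hQn))).add hT'

/-- The order of both sides of `a * (1 - P ^ m) * (1 - Q ^ n) = -e * T`. In particular the right hand
side cannot vanish, so four corners alone satisfy no relation. -/
theorem ord_of_rectangle (hv : TrivialOn (ZMod p) v) {P Q T : K}
    (hP : v (1 - P) = ((1 : ℤ) : WithTop ℤ)) (hQ : v Q = ((2 : ℤ) : WithTop ℤ)) {j : ℤ}
    (hT : v T = (j : WithTop ℤ)) {a b c d e : ZMod p} {m n : ℕ} (hm : 0 < m) (hn : 0 < n)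
    (ha : a ≠ 0) (hb : b = -a) (hc : c = -a) (hd : d = a)
    (h : algebraMap (ZMod p) K a + algebraMap (ZMod p) K b * P ^ m
      + algebraMap (ZMod p) K c * Q ^ n + algebraMap (ZMod p) K d * (P ^ m * Q ^ n)
      + algebraMap (ZMod p) K e * T = 0) :
    e ≠ 0 ∧ ((p ^ padicValNat p m : ℕ) : ℤ) = j := by
  have had := hd.symm
  subst hb hc had
  have h1 := ord_mul (hv a ha) (ord_mul (ord_one_sub_pow hv hP hm.ne')
    (ord_one_sub_of_pos (ord_pow hQ n) (by lia)))
  have h2 : algebraMap (ZMod p) K a * ((1 - P ^ m) * (1 - Q ^ n)) =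
      algebraMap (ZMod p) K (-e) * T := by
    simp only [map_neg] at h ⊢
    linear_combination h
  have he : e ≠ 0 := by
    rintro rfl
    rw [h2, neg_zero, map_zero, zero_mul, v.map_zero] at h1
    exact WithTop.top_ne_coe h1
  refine ⟨he, ?_⟩
  rw [h2] at h1
  have := ord_unique h1 (ord_mul (hv _ (neg_ne_zero.mpr he)) hT)
  lia

variable {X Y : K}

/-- A relation on the curve between the corners of a rectangle with edges along `U` and `V`, and
one further monomial in this rectangle, is up to a scalar
`(1 - U ^ q) * (1 - V ^ q) = const * X ^ q` with `q` a power of `p`. The orders of both sides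
at the four points at infinity leave no other possibility. -/
theorem rectangle_relation (hpl : IsPlace p v X Y) {m n : ℕ} (hm : 0 < m) (hn : 0 < n) {k l : ℤ}
    (hs0 : 0 ≤ k + l) (hs1 : k + l ≤ 2 * m) (ht0 : 0 ≤ k - l) (ht1 : k - l ≤ 2 * n)
    {a b c d e : ZMod p} (ha : a ≠ 0)
    (hcorner : e = 0 ∨ ¬ ((k + l = 0 ∨ k + l = 2 * m) ∧ (k - l = 0 ∨ k - l = 2 * n)))
    (H : ∀ X Y : K, OnCurve X Y →
      algebraMap (ZMod p) K a + algebraMap (ZMod p) K b * (-(X * Y)) ^ m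
        + algebraMap (ZMod p) K c * (-(X * Y⁻¹)) ^ n
        + algebraMap (ZMod p) K d * ((-(X * Y)) ^ m * (-(X * Y⁻¹)) ^ n)
        + algebraMap (ZMod p) K e * (X ^ k * Y ^ l) = 0) :
    b = -a ∧ c = -a ∧ d = a ∧ e ≠ 0 ∧ ∃ r : ℕ, m = p ^ r ∧ n = p ^ r ∧ k = ((p ^ r : ℕ) : ℤ) ∧
      l = 0 := by
  have hv := hpl.trivialOn
  have hP := hpl.hasResidue_one
  have hP1 := hpl.ord_one_sub
  have hQ := hpl.ord_neg_div
  have hX := hpl.ord_left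
  have hY := hpl.ord_right
  have hQ0 := ne_zero_of_ord hQ
  have hinv : -(Y * X⁻¹) = (-(X * Y⁻¹))⁻¹ := by simp
  -- the symmetric points put `(U, V)` at `(P, Q)`, `(P, Q⁻¹)`, `(Q, P)` and `(Q⁻¹, P)`
  have E1 := H X Y hpl.onCurve
  have E2 := H Y X hpl.onCurve.swap
  have E3 := H X Y⁻¹ hpl.onCurve.inv_right
  have E4 := H Y X⁻¹ hpl.onCurve.swap.inv_right
  rw [hinv, mul_comm Y X] at E2
  rw [inv_inv] at E3
  rw [inv_inv, hinv, mul_comm Y X] at E4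
  have T1 : v (X ^ k * Y ^ l) = ((k - l : ℤ) : WithTop ℤ) := by
    rw [ord_mul (ord_zpow hX k) (ord_zpow hY l)]; congr 1; ring
  have T2 : v ((-(X * Y⁻¹)) ^ n * (Y ^ k * X ^ l)) = ((2 * n - (k - l) : ℤ) : WithTop ℤ) := by
    rw [ord_mul (ord_pow hQ n) (ord_mul (ord_zpow hY k) (ord_zpow hX l))]; congr 1; ring
  have T3 : v (X ^ k * Y⁻¹ ^ l) = ((k + l : ℤ) : WithTop ℤ) := by
    rw [ord_mul (ord_zpow hX k) (ord_zpow (ord_inv hY) l)]; congr 1; ring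
  have T4 : v ((-(X * Y⁻¹)) ^ m * (Y ^ k * X⁻¹ ^ l)) = ((2 * m - (k + l) : ℤ) : WithTop ℤ) := by
    rw [ord_mul (ord_pow hQ m) (ord_mul (ord_zpow hY k) (ord_zpow (ord_inv hX) l))]
    congr 1; ring
  generalize -(X * Y) = P at *
  generalize -(X * Y⁻¹) = Q at *
  have hcancel : ∀ N : ℕ, Q ^ N * Q⁻¹ ^ N = 1 := fun N => by
    rw [← mul_pow, mul_inv_cancel₀ hQ0, one_pow]
  have R2 : algebraMap (ZMod p) K c + algebraMap (ZMod p) K d * P ^ m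
      + algebraMap (ZMod p) K a * Q ^ n + algebraMap (ZMod p) K b * (P ^ m * Q ^ n)
      + algebraMap (ZMod p) K e * (Q ^ n * (Y ^ k * X ^ l)) = 0 := by
    linear_combination Q ^ n * E2
      - (algebraMap (ZMod p) K c + algebraMap (ZMod p) K d * P ^ m) * hcancel n
  have R3 : algebraMap (ZMod p) K a + algebraMap (ZMod p) K c * P ^ n
      + algebraMap (ZMod p) K b * Q ^ m + algebraMap (ZMod p) K d * (P ^ n * Q ^ m)
      + algebraMap (ZMod p) K e * (X ^ k * Y⁻¹ ^ l) = 0 := by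
    linear_combination E3
  have R4 : algebraMap (ZMod p) K b + algebraMap (ZMod p) K d * P ^ n
      + algebraMap (ZMod p) K a * Q ^ m + algebraMap (ZMod p) K c * (P ^ n * Q ^ m)
      + algebraMap (ZMod p) K e * (Q ^ m * (Y ^ k * X⁻¹ ^ l)) = 0 := by
    linear_combination Q ^ m * E4
      - (algebraMap (ZMod p) K b + algebraMap (ZMod p) K d * P ^ n) * hcancel m
  have h1 : e = 0 ∨ 0 < k - l → a + b = 0 := fun h =>
    add_eq_zero_of_rectangle hv hP hQ T1 hn h E1
  have h2 : e = 0 ∨ 0 < 2 * n - (k - l) → c + d = 0 := fun h =>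
    add_eq_zero_of_rectangle hv hP hQ T2 hn h R2
  have h3 : e = 0 ∨ 0 < k + l → a + c = 0 := fun h =>
    add_eq_zero_of_rectangle hv hP hQ T3 hm h R3
  have h4 : e = 0 ∨ 0 < 2 * m - (k + l) → b + d = 0 := fun h =>
    add_eq_zero_of_rectangle hv hP hQ T4 hm h R4
  -- three of the four edges contain only their corners, and any three of these conditions suffice
  obtain ⟨hb, hc, hd⟩ : b = -a ∧ c = -a ∧ d = a := by
    have key : (a + b = 0 ∧ c + d = 0 ∧ (a + c = 0 ∨ b + d = 0)) ∨
        (a + c = 0 ∧ b + d = 0 ∧ (a + b = 0 ∨ c + d = 0)) := by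
      by_cases he : e = 0
      · exact Or.inl ⟨h1 (.inl he), h2 (.inl he), .inl (h3 (.inl he))⟩
      · have hcorner := hcorner.resolve_left he
        by_cases hk : k - l = 0 ∨ k - l = 2 * n
        · refine Or.inr ⟨h3 (.inr (by lia)), h4 (.inr (by lia)), ?_⟩
          by_cases hk0 : k - l = 0
          · exact .inr (h2 (.inr (by lia)))
          · exact .inl (h1 (.inr (by lia)))
        · refine Or.inl ⟨h1 (.inr (by lia)), h2 (.inr (by lia)), ?_⟩
          by_cases hk0 : k + l = 0
          · exact .inr (h4 (.inr (by lia)))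
          · exact .inl (h3 (.inr (by lia)))
    rcases key with ⟨h1, h2, h3 | h3⟩ | ⟨h1, h2, h3 | h3⟩
    · exact ⟨by linear_combination h1, by linear_combination h3, by linear_combination h2 - h3⟩
    · exact ⟨by linear_combination h1, by linear_combination h2 + h1 - h3,
        by linear_combination h3 - h1⟩
    · exact ⟨by linear_combination h3, by linear_combination h1, by linear_combination h2 - h3⟩
    · exact ⟨by linear_combination h2 + h1 - h3, by linear_combination h1,
        by linear_combination h3 - h1⟩
  obtain ⟨he, q1⟩ := ord_of_rectangle hv hP1 hQ T1 hm hn ha hb hc hd E1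
  have hna : -a ≠ 0 := neg_ne_zero.mpr ha
  obtain ⟨-, q2⟩ := ord_of_rectangle hv hP1 hQ T2 hm hn (a := c) (by rwa [hc])
    (by rw [hc, hd, neg_neg]) (by rw [hc, neg_neg]) (by rw [hb, hc]) R2
  obtain ⟨-, q3⟩ := ord_of_rectangle hv hP1 hQ T3 hn hm ha hc hb hd R3
  obtain ⟨-, q4⟩ := ord_of_rectangle hv hP1 hQ T4 hn hm (a := b) (by rwa [hb])
    (by rw [hb, hd, neg_neg]) (by rw [hb, neg_neg]) (by rw [hb, hc]) R4
  have hn' : n = p ^ padicValNat p m := by lia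
  have hm' : m = p ^ padicValNat p n := by lia
  have hval : padicValNat p n = padicValNat p m := by
    conv_lhs => rw [hn', padicValNat.prime_pow]
  exact ⟨hb, hc, hd, he, padicValNat p m, by rw [← hval]; exact hm', hn', by lia,
    by rw [hval] at q3; lia⟩

/-- A pentagon relation read at a place where its edge is `1`, `P ^ m` and `Q ^ n'` is the nearest
further power of `Q`: the terms on the edge are balanced by that one. -/
theorem ord_of_pentagon (hv : TrivialOn (ZMod p) v) {P Q : K}
    (hP : v (1 - P) = ((1 : ℤ) : WithTop ℤ)) (hP1 : HasResidue v P (1 : ZMod p))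
    (hQ : v Q = ((2 : ℤ) : WithTop ℤ)) {m n m' n' : ℕ} (hm : 0 < m) (hn : n' < n)
    (h : 1 - P ^ m - Q ^ n + P ^ m * Q ^ n' + Q ^ n * P ^ m' = 0) :
    p ^ padicValNat p m = 2 * n' := by
  have hC : ∀ x : ZMod p, HasResidue v (algebraMap (ZMod p) K x) x := hasResidue_algebraMap
  have h1 : HasResidue v (-(P ^ m + Q ^ (n - n') * (P ^ m' - 1))) (-1 : ZMod p) := by
    have := (hC (-1)).mul hv ((hP1.pow_one hv m).add
      ((hasResidue_zero_of_ord (F := ZMod p) (ord_pow hQ (n - n')) (by lia)).mul hv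
        ((hP1.pow_one hv m').add (hC (-1)))))
    convert this using 1
    · simp only [map_neg, map_one]; ring
    · ring
  have h2 := ord_mul (ord_pow hQ n') (h1.ord hv (neg_ne_zero.mpr one_ne_zero))
  have h3 : Q ^ n' * -(P ^ m + Q ^ (n - n') * (P ^ m' - 1)) = 1 - P ^ m := by
    have : Q ^ n = Q ^ n' * Q ^ (n - n') := by rw [← pow_add]; congr 1; lia
    rw [this] at h
    linear_combination -h
  rw [h3] at h2
  have := ord_unique (ord_one_sub_pow hv hP hm.ne') h2
  lia

/-- A pentagon relation read at a place where its edge is `1`, `P ^ n'` and `Q ^ (m - m')` is the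
nearest further power of `Q`: the terms on the edge are balanced by that one. -/
theorem ord_of_pentagon' (hv : TrivialOn (ZMod p) v) {P Q : K}
    (hP : v (1 - P) = ((1 : ℤ) : WithTop ℤ)) (hP1 : HasResidue v P (1 : ZMod p))
    (hQ : v Q = ((2 : ℤ) : WithTop ℤ)) {m n m' n' : ℕ} (hm' : 0 < m') (hm : m' < m) (hn' : 0 < n')
    (h : Q ^ m * (1 - P ^ n) - (1 - P ^ n') + P ^ n * Q ^ (m - m') = 0) :
    p ^ padicValNat p n' = 2 * (m - m') := by
  have hC : ∀ x : ZMod p, HasResidue v (algebraMap (ZMod p) K x) x := hasResidue_algebraMap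
  have h1 : HasResidue v (P ^ n + Q ^ m' * (1 - P ^ n)) (1 : ZMod p) := by
    have := ((hP1.pow_one hv n).add
      ((hasResidue_zero_of_ord (F := ZMod p) (ord_pow hQ m') (by lia)).mul hv
        ((hC 1).add ((hC (-1)).mul hv (hP1.pow_one hv n)))))
    convert this using 1
    · simp only [map_neg, map_one]; ring
    · ring
  have h2 := ord_mul (ord_pow hQ (m - m')) (h1.ord hv one_ne_zero)
  have h3 : Q ^ (m - m') * (P ^ n + Q ^ m' * (1 - P ^ n)) = 1 - P ^ n' := by
    have : Q ^ m = Q ^ (m - m') * Q ^ m' := by rw [← pow_add]; congr 1; lia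
    rw [this] at h
    linear_combination h
  rw [h3] at h2
  have := ord_unique (ord_one_sub_pow hv hP hn'.ne') h2
  lia

/-- There is no relation on the curve between the vertices of a pentagon obtained by cutting off a
corner of a rectangle with edges along `U` and `V`: the orders at the four points at infinity
would force each of `m`, `n` to be larger than the other. -/
theorem pentagon_relation_nat (hpl : IsPlace p v X Y) {m n m' n' : ℕ} (hm' : 0 < m') (hm : m' < m)
    (hn' : 0 < n') (hn : n' < n) {a b c d e : ZMod p} (ha : a ≠ 0)
    (H : ∀ X Y : K, OnCurve X Y →
      algebraMap (ZMod p) K a + algebraMap (ZMod p) K b * (-(X * Y)) ^ m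
        + algebraMap (ZMod p) K c * (-(X * Y⁻¹)) ^ n
        + algebraMap (ZMod p) K d * ((-(X * Y)) ^ m * (-(X * Y⁻¹)) ^ n')
        + algebraMap (ZMod p) K e * ((-(X * Y⁻¹)) ^ n * (-(X * Y)) ^ m') = 0) : False := by
  have hv := hpl.trivialOn
  have hP1 := hpl.hasResidue_one
  have hP := hpl.ord_one_sub
  have hQ := hpl.ord_neg_div
  have hQ0 := ne_zero_of_ord hQ
  have hinv : -(Y * X⁻¹) = (-(X * Y⁻¹))⁻¹ := by simp
  -- the symmetric points put `(U, V)` at `(P, Q)`, `(P, Q⁻¹)`, `(Q, P)` and `(Q⁻¹, P)`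
  have E1 := H X Y hpl.onCurve
  have E2 := H Y X hpl.onCurve.swap
  have E3 := H X Y⁻¹ hpl.onCurve.inv_right
  have E4 := H Y X⁻¹ hpl.onCurve.swap.inv_right
  rw [hinv, mul_comm Y X] at E2
  rw [inv_inv] at E3
  rw [inv_inv, hinv, mul_comm Y X] at E4
  generalize -(X * Y) = P at *
  generalize -(X * Y⁻¹) = Q at *
  have hcancel : ∀ N : ℕ, Q ^ N * Q⁻¹ ^ N = 1 := fun N => by
    rw [← mul_pow, mul_inv_cancel₀ hQ0, one_pow]
  have hcancel' : ∀ N M : ℕ, M < N → Q ^ N * Q⁻¹ ^ M = Q ^ (N - M) := fun N M hNM => by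
    rw [show Q ^ N = Q ^ (N - M) * Q ^ M by rw [← pow_add]; congr 1; lia, mul_assoc, hcancel,
      mul_one]
  have hC : ∀ x : ZMod p, HasResidue v (algebraMap (ZMod p) K x) x := hasResidue_algebraMap
  have hQr : ∀ N : ℕ, 0 < N → HasResidue v (Q ^ N) (0 : ZMod p) := fun N hN =>
    hasResidue_zero_of_ord (ord_pow hQ N) (by lia)
  have hPr : ∀ N : ℕ, HasResidue v (P ^ N) (1 : ZMod p) := hP1.pow_one hv
  have R2 : algebraMap (ZMod p) K c + algebraMap (ZMod p) K e * P ^ m'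
      + (algebraMap (ZMod p) K a * Q ^ n + algebraMap (ZMod p) K b * (P ^ m * Q ^ n)
      + algebraMap (ZMod p) K d * (P ^ m * Q ^ (n - n'))) = 0 := by
    linear_combination Q ^ n * E2
      - (algebraMap (ZMod p) K c + algebraMap (ZMod p) K e * P ^ m') * hcancel n
      - algebraMap (ZMod p) K d * P ^ m * hcancel' n n' hn
  have R4 : algebraMap (ZMod p) K b + algebraMap (ZMod p) K d * P ^ n'
      + (algebraMap (ZMod p) K a * Q ^ m + algebraMap (ZMod p) K c * (P ^ n * Q ^ m)
      + algebraMap (ZMod p) K e * (P ^ n * Q ^ (m - m'))) = 0 := by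
    linear_combination Q ^ m * E4
      - (algebraMap (ZMod p) K b + algebraMap (ZMod p) K d * P ^ n') * hcancel m
      - algebraMap (ZMod p) K e * P ^ n * hcancel' m m' hm
  have h1 : a + b = 0 := by
    refine add_eq_zero_of_edge (m := m) (R := algebraMap (ZMod p) K c * Q ^ n +
      (algebraMap (ZMod p) K d * (P ^ m * Q ^ n') + algebraMap (ZMod p) K e * (Q ^ n * P ^ m')))
      hv hP1 ?_ (by rw [← E1]; ring)
    simpa using ((hC c).mul hv (hQr n (by lia))).add (((hC d).mul hv ((hPr m).mul hv
      (hQr n' hn'))).add ((hC e).mul hv ((hQr n (by lia)).mul hv (hPr m'))))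
  have h2 : c + e = 0 := by
    refine add_eq_zero_of_edge (m := m') hv hP1 ?_ R2
    simpa using (((hC a).mul hv (hQr n (by lia))).add ((hC b).mul hv ((hPr m).mul hv
      (hQr n (by lia))))).add ((hC d).mul hv ((hPr m).mul hv (hQr (n - n') (by lia))))
  have h3 : a + c = 0 := by
    refine add_eq_zero_of_edge (m := n) (R := algebraMap (ZMod p) K b * Q ^ m +
      (algebraMap (ZMod p) K d * (Q ^ m * P ^ n') + algebraMap (ZMod p) K e * (P ^ n * Q ^ m')))
      hv hP1 ?_ (by rw [← E3]; ring)
    simpa using ((hC b).mul hv (hQr m (by lia))).add (((hC d).mul hv ((hQr m (by lia)).mul hv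
      (hPr n'))).add ((hC e).mul hv ((hPr n).mul hv (hQr m' hm'))))
  have h4 : b + d = 0 := by
    refine add_eq_zero_of_edge (m := n') hv hP1 ?_ R4
    simpa using (((hC a).mul hv (hQr m (by lia))).add ((hC c).mul hv ((hPr n).mul hv
      (hQr m (by lia))))).add ((hC e).mul hv ((hPr n).mul hv (hQr (m - m') (by lia))))
  obtain rfl : b = -a := by linear_combination h1
  obtain rfl : c = -a := by linear_combination h3
  obtain rfl : a = d := by linear_combination -h4
  obtain rfl : a = e := by linear_combination -h2
  have ha' : algebraMap (ZMod p) K a ≠ 0 := by simpa using ha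
  simp only [map_neg] at E1 R2 E3 R4
  have q1 := ord_of_pentagon (m := m) (n := n) (m' := m') (n' := n') hv hP hP1 hQ (by lia) hn
    (mul_left_cancel₀ ha' (by linear_combination E1))
  have q3 := ord_of_pentagon (m := n) (n := m) (m' := n') (n' := m') hv hP hP1 hQ (by lia) hm
    (mul_left_cancel₀ ha' (by linear_combination E3))
  have q4 := ord_of_pentagon' (m := m) (n := n) (m' := m') (n' := n') hv hP hP1 hQ hm' hm hn'
    (mul_left_cancel₀ ha' (by linear_combination R4))
  have q2 := ord_of_pentagon' (m := n) (n := m) (m' := n') (n' := m') hv hP hP1 hQ hn' hn hm'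
    (mul_left_cancel₀ ha' (by linear_combination R2))
  -- `m ≥ 2 * n'`, `n' ≥ 2 * (m - m')` and `n ≥ 2 * m'` give `n > m`, and `m > n` by symmetry
  have hle : ∀ N : ℕ, 0 < N → p ^ padicValNat p N ≤ N := fun N hN =>
    Nat.le_of_dvd hN pow_padicValNat_dvd
  have l1 := hle m (by lia)
  have l2 := hle n (by lia)
  have l3 := hle m' (by lia)
  have l4 := hle n' (by lia)
  lia

/-- The integer version of `pentagon_relation_nat`: the sign of `m` or `n` is changed by the
symmetry `(U, V) ↦ (U⁻¹, V)` or `(U, V) ↦ (U, V⁻¹)` of the curve. -/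
theorem pentagon_relation (hpl : IsPlace p v X Y) {m n m' n' : ℤ}
    (hm : 0 < m' ∧ m' < m ∨ m < m' ∧ m' < 0) (hn : 0 < n' ∧ n' < n ∨ n < n' ∧ n' < 0)
    {a b c d e : ZMod p} (ha : a ≠ 0)
    (H : ∀ X Y : K, OnCurve X Y →
      algebraMap (ZMod p) K a + algebraMap (ZMod p) K b * (-(X * Y)) ^ m
        + algebraMap (ZMod p) K c * (-(X * Y⁻¹)) ^ n
        + algebraMap (ZMod p) K d * ((-(X * Y)) ^ m * (-(X * Y⁻¹)) ^ n')
        + algebraMap (ZMod p) K e * ((-(X * Y⁻¹)) ^ n * (-(X * Y)) ^ m') = 0) : False := by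
  wlog hm0 : 0 < m generalizing m m'
  · refine this (m := -m) (m' := -m') (by lia) (fun X Y hXY => ?_) (by lia)
    have := H Y⁻¹ X⁻¹ hXY.swap.inv_left.inv_right
    rw [inv_inv, mul_comm Y⁻¹ X, show -(Y⁻¹ * X⁻¹) = (-(X * Y))⁻¹ by simp] at this
    simpa only [inv_zpow'] using this
  wlog hn0 : 0 < n generalizing n n'
  · refine this (n := -n) (n' := -n') (by lia) (fun X Y hXY => ?_) (by lia)
    have := H Y X hXY.swap
    rw [mul_comm Y X, show -(Y * X⁻¹) = (-(X * Y⁻¹))⁻¹ by simp] at this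
    simpa only [inv_zpow'] using this
  lift m to ℕ using by lia
  lift n to ℕ using by lia
  lift m' to ℕ using by lia
  lift n' to ℕ using by lia
  refine pentagon_relation_nat (m := m) (n := n) (m' := m') (n' := n') (b := b) (c := c) (d := d)
    (e := e) hpl (by lia) (by lia) (by lia) (by lia) ha (fun X Y hXY => ?_)
  simpa only [zpow_natCast] using H X Y hXY

end Polygons

/-! ### Finite sets with two points on each side of their bounding box -/

section Corners

/-- `S` has three corners of a box with diagonal sides, and one further point on each of the two
sides through the missing corner. The middle one of the three corners is `A`; the signs of `m`, `n`
tell which corner of the box it is. -/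
def HasPentagon (S : Finset Square) : Prop :=
  ∃ A : Square, ∃ m n m' n' : ℤ, (0 < m' ∧ m' < m ∨ m < m' ∧ m' < 0) ∧
    (0 < n' ∧ n' < n ∨ n < n' ∧ n' < 0) ∧ A ∈ S ∧ A + (m, m) ∈ S ∧ A + (n, -n) ∈ S ∧
    A + (m + n', m - n') ∈ S ∧ A + (n + m', m' - n) ∈ S

/-- `S` has all four corners of its bounding box with diagonal sides. The corner `A` is the one where
`i + j` and `i - j` are least. -/
def HasRectangle (S : Finset Square) : Prop :=
  ∃ A : Square, ∃ m n : ℕ, 0 < m ∧ 0 < n ∧ A ∈ S ∧ A + ((m : ℤ), (m : ℤ)) ∈ S ∧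
    A + ((n : ℤ), -(n : ℤ)) ∈ S ∧ A + ((m : ℤ) + n, (m : ℤ) - n) ∈ S ∧
    ∀ q ∈ S, 0 ≤ (q.1 - A.1) + (q.2 - A.2) ∧ (q.1 - A.1) + (q.2 - A.2) ≤ 2 * m ∧
      0 ≤ (q.1 - A.1) - (q.2 - A.2) ∧ (q.1 - A.1) - (q.2 - A.2) ≤ 2 * n

/-- Builds a pentagon from its points, given by `s = i + j` and `t = i - j`: `A`, `B`, `C` are the
corners with `(s, t)` equal to `(a, b)`, `(a', b)`, `(a, b')`, and the corner `(a', b')` is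
missing. -/
theorem HasPentagon.of_corners {S : Finset Square} {a a' b b' : ℤ} {A B C D E : Square}
    (hA : A ∈ S) (hB : B ∈ S) (hC : C ∈ S) (hD : D ∈ S) (hE : E ∈ S)
    (hAs : A.1 + A.2 = a) (hAt : A.1 - A.2 = b) (hBs : B.1 + B.2 = a') (hBt : B.1 - B.2 = b)
    (hCs : C.1 + C.2 = a) (hCt : C.1 - C.2 = b') (hDs : D.1 + D.2 = a') (hEt : E.1 - E.2 = b')
    (hDB : D ≠ B) (hEC : E ≠ C)
    (hbd : ∀ q ∈ S, (a ≤ q.1 + q.2 ∧ q.1 + q.2 ≤ a' ∨ a' ≤ q.1 + q.2 ∧ q.1 + q.2 ≤ a) ∧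
      (b ≤ q.1 - q.2 ∧ q.1 - q.2 ≤ b' ∨ b' ≤ q.1 - q.2 ∧ q.1 - q.2 ≤ b))
    (hno : ∀ q ∈ S, q.1 + q.2 = a' → q.1 - q.2 = b' → False) : HasPentagon S := by
  have h1 := hbd D hD
  have h2 := hbd E hE
  have h3 : D.1 - D.2 ≠ b' := hno D hD hDs
  have h4 : E.1 + E.2 ≠ a' := fun h => hno E hE h hEt
  rw [Ne, Prod.ext_iff] at hDB hEC
  refine ⟨A, B.1 - A.1, C.1 - A.1, E.1 - C.1, D.1 - B.1, by omega, by omega, hA, ?_, ?_, ?_, ?_⟩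
  · convert hB using 1; ext <;> simp; omega
  · convert hC using 1; ext <;> simp; omega
  · convert hD using 1; ext <;> simp; omega
  · convert hE using 1; ext <;> simp; omega

/-- A point lies on at most two sides of the bounding box, and on two only if it is a corner. Hence
a set of at most five points with two points on each side has three of the four corners. -/
theorem hasRectangle_or_hasPentagon {S : Finset Square} (hcard : S.card ≤ 5) (hne : S.Nonempty)
    (hface : ∀ α β : ℤ, (α = 1 ∨ α = -1) → (β = 1 ∨ β = -1) → ∀ q ∈ S,
      (∀ r ∈ S, α * q.1 + β * q.2 ≤ α * r.1 + β * r.2) →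
      ∃ r ∈ S, r ≠ q ∧ α * r.1 + β * r.2 = α * q.1 + β * q.2) :
    HasRectangle S ∨ HasPentagon S := by
  obtain ⟨x0, hx0, hx0m⟩ := S.exists_min_image (fun q => 1 * q.1 + 1 * q.2) hne
  obtain ⟨x1, hx1, hx1m⟩ := S.exists_min_image (fun q => (-1) * q.1 + (-1) * q.2) hne
  obtain ⟨y0, hy0, hy0m⟩ := S.exists_min_image (fun q => 1 * q.1 + (-1) * q.2) hne
  obtain ⟨y1, hy1, hy1m⟩ := S.exists_min_image (fun q => (-1) * q.1 + 1 * q.2) hne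
  obtain ⟨x0', hx0', nx0, ex0⟩ := hface 1 1 (by simp) (by simp) x0 hx0 hx0m
  obtain ⟨x1', hx1', nx1, ex1⟩ := hface (-1) (-1) (by simp) (by simp) x1 hx1 hx1m
  obtain ⟨y0', hy0', ny0, ey0⟩ := hface 1 (-1) (by simp) (by simp) y0 hy0 hy0m
  obtain ⟨y1', hy1', ny1, ey1⟩ := hface (-1) 1 (by simp) (by simp) y1 hy1 hy1m
  have hbd : ∀ q ∈ S, x0.1 + x0.2 ≤ q.1 + q.2 ∧ q.1 + q.2 ≤ x1.1 + x1.2 ∧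
      y0.1 - y0.2 ≤ q.1 - q.2 ∧ q.1 - q.2 ≤ y1.1 - y1.2 := fun q hq => by
    have := hx0m q hq
    have := hx1m q hq
    have := hy0m q hq
    have := hy1m q hq
    omega
  obtain ⟨s0, hs0⟩ : ∃ s, s = x0.1 + x0.2 := ⟨_, rfl⟩
  obtain ⟨s1, hs1⟩ : ∃ s, s = x1.1 + x1.2 := ⟨_, rfl⟩
  obtain ⟨t0, ht0⟩ : ∃ s, s = y0.1 - y0.2 := ⟨_, rfl⟩
  obtain ⟨t1, ht1⟩ : ∃ s, s = y1.1 - y1.2 := ⟨_, rfl⟩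
  rw [← hs0, ← hs1, ← ht0, ← ht1] at hbd
  have hs : s0 < s1 := by
    have := hbd y0 hy0
    have := hbd y0' hy0'
    rw [Ne, Prod.ext_iff] at ny0
    omega
  have ht : t0 < t1 := by
    have := hbd x0 hx0
    have := hbd x0' hx0'
    rw [Ne, Prod.ext_iff] at nx0
    omega
  -- each side has a point different from a given one
  have F0 : ∀ B : Square, ∃ q ∈ S, q.1 + q.2 = s0 ∧ q ≠ B := fun B => by
    by_cases h : x0 = B
    · exact ⟨x0', hx0', by omega, h ▸ nx0⟩
    · exact ⟨x0, hx0, by omega, h⟩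
  have F1 : ∀ B : Square, ∃ q ∈ S, q.1 + q.2 = s1 ∧ q ≠ B := fun B => by
    by_cases h : x1 = B
    · exact ⟨x1', hx1', by omega, h ▸ nx1⟩
    · exact ⟨x1, hx1, by omega, h⟩
  have G0 : ∀ B : Square, ∃ q ∈ S, q.1 - q.2 = t0 ∧ q ≠ B := fun B => by
    by_cases h : y0 = B
    · exact ⟨y0', hy0', by omega, h ▸ ny0⟩
    · exact ⟨y0, hy0, by omega, h⟩
  have G1 : ∀ B : Square, ∃ q ∈ S, q.1 - q.2 = t1 ∧ q ≠ B := fun B => by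
    by_cases h : y1 = B
    · exact ⟨y1', hy1', by omega, h ▸ ny1⟩
    · exact ⟨y1, hy1, by omega, h⟩
  have two : ∀ P : Square → Prop, [DecidablePred P] →
      (∀ B : Square, ∃ q ∈ S, P q ∧ q ≠ B) → 2 ≤ (S.filter P).card := fun P _ h => by
    obtain ⟨q, hq, hPq, -⟩ := h 0
    obtain ⟨r, hr, hPr, hrq⟩ := h q
    exact Finset.one_lt_card.mpr ⟨r, by simp [hr, hPr], q, by simp [hq, hPq], hrq⟩
  have K0 := two _ F0
  have K1 := two _ F1
  have L0 := two _ G0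
  have L1 := two _ G1
  -- `κ a b` is `1` or `0` according to whether the corner `(a, b)` is in `S`
  let κ : ℤ → ℤ → ℕ := fun a b => (S.filter fun q => q.1 + q.2 = a ∧ q.1 - q.2 = b).card
  have hκ : ∀ a b, κ a b ≤ 1 := fun a b => Finset.card_le_one.mpr fun q hq r hr => by
    simp only [Finset.mem_filter] at hq hr
    ext <;> omega
  have hκ1 : ∀ a b, κ a b ≠ 0 → ∃ q ∈ S, q.1 + q.2 = a ∧ q.1 - q.2 = b := fun a b h => by
    obtain ⟨q, hq⟩ := Finset.card_pos.mp (Nat.pos_of_ne_zero h)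
    exact ⟨q, by simpa using hq⟩
  have hκ0 : ∀ a b, κ a b = 0 → ∀ q ∈ S, q.1 + q.2 = a → q.1 - q.2 = b → False :=
    fun a b h q hq ha hb => by
      have := Finset.card_eq_zero.mp h
      exact Finset.notMem_empty q (this ▸ Finset.mem_filter.mpr ⟨hq, ha, hb⟩)
  have hsum : (S.filter fun q => q.1 + q.2 = s0).card + (S.filter fun q => q.1 + q.2 = s1).card
      + ((S.filter fun q => q.1 - q.2 = t0).card + (S.filter fun q => q.1 - q.2 = t1).card) ≤
      S.card + (κ s0 t0 + κ s0 t1 + (κ s1 t0 + κ s1 t1)) := by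
    simp only [κ]
    rw [Finset.card_eq_sum_ones S]
    simp only [Finset.card_filter, ← Finset.sum_add_distrib]
    refine Finset.sum_le_sum fun q _ => ?_
    split_ifs <;> omega
  have k00 := hκ s0 t0
  have k01 := hκ s0 t1
  have k10 := hκ s1 t0
  have k11 := hκ s1 t1
  have hbd' : ∀ q ∈ S, (s0 ≤ q.1 + q.2 ∧ q.1 + q.2 ≤ s1) ∧ (t0 ≤ q.1 - q.2 ∧ q.1 - q.2 ≤ t1) :=
    fun q hq => by have := hbd q hq; omega
  by_cases h00 : κ s0 t0 = 0
  · right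
    obtain ⟨A, hA, hAs, hAt⟩ := hκ1 s1 t1 (by omega)
    obtain ⟨B, hB, hBs, hBt⟩ := hκ1 s0 t1 (by omega)
    obtain ⟨C, hC, hCs, hCt⟩ := hκ1 s1 t0 (by omega)
    obtain ⟨D, hD, hDs, hDB⟩ := F0 B
    obtain ⟨E, hE, hEt, hEC⟩ := G0 C
    exact .of_corners hA hB hC hD hE hAs hAt hBs hBt hCs hCt hDs hEt hDB hEC
      (fun q hq => ⟨.inr (hbd' q hq).1, .inr (hbd' q hq).2⟩) (hκ0 _ _ h00)
  by_cases h01 : κ s0 t1 = 0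
  · right
    obtain ⟨A, hA, hAs, hAt⟩ := hκ1 s1 t0 (by omega)
    obtain ⟨B, hB, hBs, hBt⟩ := hκ1 s0 t0 (by omega)
    obtain ⟨C, hC, hCs, hCt⟩ := hκ1 s1 t1 (by omega)
    obtain ⟨D, hD, hDs, hDB⟩ := F0 B
    obtain ⟨E, hE, hEt, hEC⟩ := G1 C
    exact .of_corners hA hB hC hD hE hAs hAt hBs hBt hCs hCt hDs hEt hDB hEC
      (fun q hq => ⟨.inr (hbd' q hq).1, .inl (hbd' q hq).2⟩) (hκ0 _ _ h01)
  by_cases h10 : κ s1 t0 = 0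
  · right
    obtain ⟨A, hA, hAs, hAt⟩ := hκ1 s0 t1 (by omega)
    obtain ⟨B, hB, hBs, hBt⟩ := hκ1 s1 t1 (by omega)
    obtain ⟨C, hC, hCs, hCt⟩ := hκ1 s0 t0 (by omega)
    obtain ⟨D, hD, hDs, hDB⟩ := F1 B
    obtain ⟨E, hE, hEt, hEC⟩ := G0 C
    exact .of_corners hA hB hC hD hE hAs hAt hBs hBt hCs hCt hDs hEt hDB hEC
      (fun q hq => ⟨.inl (hbd' q hq).1, .inr (hbd' q hq).2⟩) (hκ0 _ _ h10)
  obtain ⟨A, hA, hAs, hAt⟩ := hκ1 s0 t0 (by omega)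
  obtain ⟨B, hB, hBs, hBt⟩ := hκ1 s1 t0 (by omega)
  obtain ⟨C, hC, hCs, hCt⟩ := hκ1 s0 t1 (by omega)
  by_cases h11 : κ s1 t1 = 0
  · right
    obtain ⟨D, hD, hDs, hDB⟩ := F1 B
    obtain ⟨E, hE, hEt, hEC⟩ := G1 C
    exact .of_corners hA hB hC hD hE hAs hAt hBs hBt hCs hCt hDs hEt hDB hEC
      (fun q hq => ⟨.inl (hbd' q hq).1, .inl (hbd' q hq).2⟩) (hκ0 _ _ h11)
  obtain ⟨D, hD, hDs, hDt⟩ := hκ1 s1 t1 (by omega)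
  left
  have hm : ((B.1 - A.1).toNat : ℤ) = B.1 - A.1 := by omega
  have hn : ((C.1 - A.1).toNat : ℤ) = C.1 - A.1 := by omega
  refine ⟨A, (B.1 - A.1).toNat, (C.1 - A.1).toNat, by omega, by omega, hA, ?_, ?_, ?_, ?_⟩
  · convert hB using 1; ext <;> simp only [Prod.fst_add, Prod.snd_add] <;> omega
  · convert hC using 1; ext <;> simp only [Prod.fst_add, Prod.snd_add] <;> omega
  · convert hD using 1; ext <;> simp only [Prod.fst_add, Prod.snd_add] <;> omega
  · intro q hq
    have := hbd q hq
    omega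

end Corners

/-! ### Laurent polynomials and evolution -/

section Algebra

variable {p : ℕ} [Fact p.Prime]

variable {K : Type*} [Field K] [Algebra (ZMod p) K]

/-- Evaluation of Laurent polynomials at nonzero `X`, `Y`. -/
noncomputable def evalAt (p : ℕ) [Fact p.Prime] {K : Type*} [Field K] [Algebra (ZMod p) K] {X Y : K}
    (hX : X ≠ 0) (hY : Y ≠ 0) : Laurent p →ₐ[ZMod p] K :=
  AddMonoidAlgebra.lift (ZMod p) K Square
    { toFun := fun q => X ^ q.toAdd.1 * Y ^ q.toAdd.2
      map_one' := by simp
      map_mul' := fun q r => by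
        simp only [toAdd_mul, Prod.fst_add, Prod.snd_add, zpow_add₀ hX, zpow_add₀ hY]
        ring }

theorem evalAt_apply {X Y : K} (hX : X ≠ 0) (hY : Y ≠ 0) (f : Laurent p) :
    evalAt p hX hY f =
      f.coeff.sum (fun q a => algebraMap (ZMod p) K a * (X ^ q.1 * Y ^ q.2)) := by
  rw [evalAt, AddMonoidAlgebra.lift_apply']
  rfl

theorem evalAt_single {X Y : K} (hX : X ≠ 0) (hY : Y ≠ 0) (q : Square) (a : ZMod p) :
    evalAt p hX hY (AddMonoidAlgebra.single q a) =
      algebraMap (ZMod p) K a * (X ^ q.1 * Y ^ q.2) := by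
  rw [evalAt, AddMonoidAlgebra.lift_single, Algebra.smul_def]
  rfl

theorem evalAt_g {X Y : K} (h : OnCurve X Y) : evalAt p h.1 h.2 (g p) = 0 := by
  have := h.3
  simp only [g, map_add, evalAt_single]
  simp
  linear_combination this

theorem sum_eq_zero_of_dvd {f : Laurent p} (hf : g p ∣ f) {X Y : K} (h : OnCurve X Y) :
    f.coeff.sum (fun q a => algebraMap (ZMod p) K a * (X ^ q.1 * Y ^ q.2)) = 0 := by
  obtain ⟨f', rfl⟩ := hf
  rw [← evalAt_apply h.1 h.2, map_mul, evalAt_g h, zero_mul]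

theorem state_eq_coeff (c : Clicks p) (q : Square) :
    state c q = (AddMonoidAlgebra.ofCoeff c * g p : Laurent p).coeff q := by
  have key : ∀ r : Square, (AddMonoidAlgebra.ofCoeff c * AddMonoidAlgebra.single r 1 :
      Laurent p).coeff q = c (q - r) := fun r => by
    rw [AddMonoidAlgebra.coeff_mul_single_eq_coeff_mul (m₂ := q - r)]
    · simp
    · intro m' _
      exact eq_sub_iff_add_eq.symm
  simp only [g, mul_add, AddMonoidAlgebra.coeff_add, Finsupp.add_apply, key, state]
  simp only [Prod.mk_zero_zero, sub_eq_add_neg, Prod.neg_mk, neg_neg, neg_zero, add_zero]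
  ring

theorem lit_eq_support (c : Clicks p) :
    lit c = ((AddMonoidAlgebra.ofCoeff c * g p : Laurent p).coeff.support : Set Square) := by
  ext q
  simp [lit, state_eq_coeff]

instance charP_laurent : CharP (Laurent p) p :=
  charP_of_injective_algebraMap (algebraMap (ZMod p) (Laurent p)).injective p

theorem single_pow_prime_pow (q : Square) (a : ZMod p) (r : ℕ) :
    (AddMonoidAlgebra.single q a : Laurent p) ^ p ^ r =
      AddMonoidAlgebra.single (((p ^ r : ℕ) : ℤ) * q.1, ((p ^ r : ℕ) : ℤ) * q.2) a := by
  rw [AddMonoidAlgebra.single_pow, ZMod.pow_card_pow]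
  congr 1

theorem g_pow_prime_pow (r : ℕ) : g p ^ p ^ r =
    AddMonoidAlgebra.single (((p ^ r : ℕ) : ℤ), 0) 1
      + AddMonoidAlgebra.single (0, ((p ^ r : ℕ) : ℤ)) 1 + AddMonoidAlgebra.single (0, 0) 1
      + AddMonoidAlgebra.single (-((p ^ r : ℕ) : ℤ), 0) 1
      + AddMonoidAlgebra.single (0, -((p ^ r : ℕ) : ℤ)) 1 := by
  simp only [g, add_pow_char_pow, single_pow_prime_pow, mul_one, mul_zero, mul_neg]

theorem g_ne_zero : g p ≠ 0 := by
  intro h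
  have := congrArg (fun f : Laurent p => f.coeff (1, 0)) h
  simp [g] at this

/-- Over `ℤ/pℤ`, replacing `x`, `y` by `x ^ p`, `y ^ p` turns `g` into `g ^ p`. -/
theorem evo_single_mul_g_pow (k₀ : ZMod p) (n : ℕ) :
    evo p (AddMonoidAlgebra.single (0, 0) k₀ * g p ^ n) =
      AddMonoidAlgebra.single (0, 0) k₀ * g p ^ (p * n + (p - 1)) := by
  let e : Square →+ Square :=
    AddMonoidHom.prodMap (AddMonoidHom.mulLeft (p : ℤ)) (AddMonoidHom.mulLeft (p : ℤ))
  have h : ∀ f : Laurent p, AddMonoidAlgebra.mapDomain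
      (fun q : Square => ((p : ℤ) * q.1, (p : ℤ) * q.2)) f =
      AddMonoidAlgebra.mapDomainRingHom (ZMod p) e f := fun f => rfl
  have hg : AddMonoidAlgebra.mapDomainRingHom (ZMod p) e (g p) = g p ^ p := by
    have := g_pow_prime_pow (p := p) 1
    rw [pow_one] at this
    rw [this, ← h]
    simp [g, AddMonoidAlgebra.mapDomain_add, AddMonoidAlgebra.mapDomain_single]
  rw [evo, h, map_mul, map_pow, hg, ← h, AddMonoidAlgebra.mapDomain_single, mul_assoc, ← pow_mul,
    ← pow_add]
  simp

/-- The evolution of a single square is a power of `g` up to a constant: one evolution raises the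
exponent from `p ^ n - 1` to `p * (p ^ n - 1) + (p - 1) = p ^ (n + 1) - 1`. -/
theorem iterate_evo_single (k₀ : ZMod p) (n : ℕ) :
    (evo p)^[n] (AddMonoidAlgebra.single (0, 0) k₀) =
      AddMonoidAlgebra.single (0, 0) k₀ * g p ^ (p ^ n - 1) := by
  induction n with
  | zero => simp
  | succ n ih =>
    rw [Function.iterate_succ_apply', ih, evo_single_mul_g_pow]
    congr 2
    have h1 : 0 < p ^ n := pow_pos (Fact.out : p.Prime).pos n
    have h2 := (Fact.out : p.Prime).pos
    have h3 : 1 ≤ p ^ (n + 1) := pow_pos h2 (n + 1)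
    zify [Nat.one_le_iff_ne_zero.mpr h1.ne', h2, h3]
    ring

/-- As `g` is not a zero divisor, clicks are determined by the state they produce. -/
theorem translate_iff (c : Clicks p) (n : ℕ) (k₀ : ZMod p) (u : Square) :
    (∀ q, c q = evoPattern p n k₀ (q - u)) ↔
      (AddMonoidAlgebra.ofCoeff c : Laurent p) * g p =
        AddMonoidAlgebra.single u k₀ * g p ^ p ^ n := by
  have h1 : (AddMonoidAlgebra.single u k₀ : Laurent p) =
      AddMonoidAlgebra.single (0, 0) k₀ * AddMonoidAlgebra.single u 1 := by
    rw [AddMonoidAlgebra.single_mul_single, mul_one, Prod.mk_zero_zero, zero_add]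
  have h2 : g p ^ p ^ n = g p ^ (p ^ n - 1) * g p := by
    rw [← pow_succ, Nat.sub_add_cancel (pow_pos (Fact.out : p.Prime).pos n)]
  have h3 : (AddMonoidAlgebra.single u k₀ : Laurent p) * g p ^ p ^ n =
      ((AddMonoidAlgebra.single (0, 0) k₀ * g p ^ (p ^ n - 1)) * AddMonoidAlgebra.single u 1)
        * g p := by
    rw [h1, h2]; ring
  rw [h3, mul_left_inj' g_ne_zero, ← AddMonoidAlgebra.coeff_inj, Finsupp.ext_iff]
  refine forall_congr' fun q => ?_
  rw [evoPattern, iterate_evo_single,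
    AddMonoidAlgebra.coeff_mul_single_eq_coeff_mul (m₂ := q - u)]
  · simp
  · intro m' _
    exact eq_sub_iff_add_eq.symm

end Algebra

/-! ### Multiples of `g` with few terms -/

section Classification

variable {p : ℕ} [Fact p.Prime] {K : Type*} [Field K] [Algebra (ZMod p) K]

theorem sum_single_coeff (f : Laurent p) :
    ∑ q ∈ f.coeff.support, AddMonoidAlgebra.single q (f.coeff q) = f := by
  apply AddMonoidAlgebra.coeff_injective
  rw [AddMonoidAlgebra.coeff_sum]
  exact Finsupp.sum_single f.coeff

theorem monomial_add_diag {X Y : K} (hX : X ≠ 0) (hY : Y ≠ 0) (i j m : ℤ) :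
    X ^ (i + m) * Y ^ (j + m) = X ^ i * Y ^ j * ((-1) ^ m * (-(X * Y)) ^ m) := by
  rw [← mul_zpow, neg_one_mul, neg_neg, mul_zpow, zpow_add₀ hX, zpow_add₀ hY]
  ring

theorem monomial_add_antidiag {X Y : K} (hX : X ≠ 0) (hY : Y ≠ 0) (i j n : ℤ) :
    X ^ (i + n) * Y ^ (j - n) = X ^ i * Y ^ j * ((-1) ^ n * (-(X * Y⁻¹)) ^ n) := by
  rw [← mul_zpow, neg_one_mul, neg_neg, mul_zpow, zpow_add₀ hX, sub_eq_add_neg, zpow_add₀ hY,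
    zpow_neg, inv_zpow]
  ring

theorem monomial_add_corner {X Y : K} (hX : X ≠ 0) (hY : Y ≠ 0) (i j m n : ℤ) :
    X ^ (i + (m + n)) * Y ^ (j + (m - n)) = X ^ i * Y ^ j *
      (((-1) ^ m * (-(X * Y)) ^ m) * ((-1) ^ n * (-(X * Y⁻¹)) ^ n)) := by
  rw [← add_assoc, ← add_sub_assoc, monomial_add_antidiag hX hY, monomial_add_diag hX hY]
  ring

/-- The support of a multiple of `g` is not a pentagon. The signs of the monomials `x * y = -U` and
`x * y⁻¹ = -V` are absorbed into the coefficients. -/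
theorem not_hasPentagon {f : Laurent p} (hf : g p ∣ f) (hcard : f.coeff.support.card ≤ 5) :
    ¬ HasPentagon f.coeff.support := by
  rintro ⟨A, m, n, m', n', hm, hn, hA, hB, hC, hD, hE⟩
  obtain ⟨X, Y, hpl⟩ := exists_isPlace p
  have n1 : A ∉ ({A + (m, m), A + (n, -n), A + (m + n', m - n'), A + (n + m', m' - n)} :
      Finset Square) := by
    simp only [Finset.mem_insert, Finset.mem_singleton, Prod.ext_iff, Prod.fst_add, Prod.snd_add]
    omega
  have n2 : A + (m, m) ∉ ({A + (n, -n), A + (m + n', m - n'), A + (n + m', m' - n)} :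
      Finset Square) := by
    simp only [Finset.mem_insert, Finset.mem_singleton, Prod.ext_iff, Prod.fst_add, Prod.snd_add]
    omega
  have n3 : A + (n, -n) ∉ ({A + (m + n', m - n'), A + (n + m', m' - n)} : Finset Square) := by
    simp only [Finset.mem_insert, Finset.mem_singleton, Prod.ext_iff, Prod.fst_add, Prod.snd_add]
    omega
  have n4 : A + (m + n', m - n') ∉ ({A + (n + m', m' - n)} : Finset Square) := by
    simp only [Finset.mem_singleton, Prod.ext_iff, Prod.fst_add, Prod.snd_add]
    omega
  have hS : {A, A + (m, m), A + (n, -n), A + (m + n', m - n'), A + (n + m', m' - n)} =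
      f.coeff.support := by
    apply Finset.eq_of_subset_of_card_le
    · intro q
      simp only [Finset.mem_insert, Finset.mem_singleton]
      rintro (rfl | rfl | rfl | rfl | rfl) <;> assumption
    · rw [Finset.card_insert_of_notMem n1, Finset.card_insert_of_notMem n2,
        Finset.card_insert_of_notMem n3, Finset.card_insert_of_notMem n4, Finset.card_singleton]
      exact hcard
  refine pentagon_relation (a := f.coeff A) (b := f.coeff (A + (m, m)) * (-1) ^ m)
    (c := f.coeff (A + (n, -n)) * (-1) ^ n)
    (d := f.coeff (A + (m + n', m - n')) * ((-1) ^ m * (-1) ^ n'))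
    (e := f.coeff (A + (n + m', m' - n)) * ((-1) ^ n * (-1) ^ m')) hpl hm hn
    (Finsupp.mem_support_iff.mp hA) (fun X Y h => ?_)
  have h0 := sum_eq_zero_of_dvd hf h
  rw [Finsupp.sum, ← hS, Finset.sum_insert n1, Finset.sum_insert n2, Finset.sum_insert n3,
    Finset.sum_insert n4, Finset.sum_singleton] at h0
  simp only [Prod.fst_add, Prod.snd_add, ← sub_eq_add_neg] at h0
  rw [add_comm n m', monomial_add_diag h.1 h.2, monomial_add_antidiag h.1 h.2,
    monomial_add_corner h.1 h.2, monomial_add_corner h.1 h.2] at h0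
  have hne : X ^ A.1 * Y ^ A.2 ≠ 0 := mul_ne_zero (zpow_ne_zero _ h.1) (zpow_ne_zero _ h.2)
  apply mul_left_cancel₀ hne
  rw [add_comm n m']
  simp only [map_mul, map_zpow₀, map_neg, map_one]
  linear_combination h0

/-- A multiple of `g` with at most five terms whose support has four corners of its bounding box is
`a * x ^ u * g ^ q`, as `(1 - U) * (1 - V) = x * (g - 1)` and `q` is a power of `p`. -/
theorem exists_eq_of_hasRectangle {f : Laurent p} (hf : g p ∣ f)
    (hcard : f.coeff.support.card ≤ 5) (hS : HasRectangle f.coeff.support) :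
    ∃ (r : ℕ) (a : ZMod p) (u : Square), a ≠ 0 ∧
      f = AddMonoidAlgebra.single u a * g p ^ p ^ r := by
  obtain ⟨A, m, n, hm, hn, hA, hB, hC, hD, hbd⟩ := hS
  obtain ⟨X, Y, hpl⟩ := exists_isPlace p
  have n1 : A ∉ ({A + ((m : ℤ), (m : ℤ)), A + ((n : ℤ), -(n : ℤ)), A + ((m : ℤ) + n, (m : ℤ) - n)} :
      Finset Square) := by
    simp only [Finset.mem_insert, Finset.mem_singleton, Prod.ext_iff, Prod.fst_add, Prod.snd_add]
    omega
  have n2 : A + ((m : ℤ), (m : ℤ)) ∉ ({A + ((n : ℤ), -(n : ℤ)), A + ((m : ℤ) + n, (m : ℤ) - n)} :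
      Finset Square) := by
    simp only [Finset.mem_insert, Finset.mem_singleton, Prod.ext_iff, Prod.fst_add, Prod.snd_add]
    omega
  have n3 : A + ((n : ℤ), -(n : ℤ)) ∉ ({A + ((m : ℤ) + n, (m : ℤ) - n)} : Finset Square) := by
    simp only [Finset.mem_singleton, Prod.ext_iff, Prod.fst_add, Prod.snd_add]
    omega
  set T : Finset Square := {A, A + ((m : ℤ), (m : ℤ)), A + ((n : ℤ), -(n : ℤ)),
    A + ((m : ℤ) + n, (m : ℤ) - n)} with hT
  have hTS : T ⊆ f.coeff.support := by
    intro q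
    simp only [hT, Finset.mem_insert, Finset.mem_singleton]
    rintro (rfl | rfl | rfl | rfl) <;> assumption
  have hTcard : T.card = 4 := by
    rw [hT, Finset.card_insert_of_notMem n1, Finset.card_insert_of_notMem n2,
      Finset.card_insert_of_notMem n3, Finset.card_singleton]
  -- a coefficient `ε = 0` stands for the absence of a fifth term
  obtain ⟨e, ε, he, hεT, hsum⟩ : ∃ (e : Square) (ε : ZMod p), e ∈ f.coeff.support ∧
      (ε = 0 ∨ e ∉ T) ∧ ∑ q ∈ T, AddMonoidAlgebra.single q (f.coeff q)
        + AddMonoidAlgebra.single e ε = f := by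
    have hle : (f.coeff.support \ T).card ≤ 1 := by
      rw [Finset.card_sdiff_of_subset hTS]; omega
    have hsplit := Finset.sum_sdiff (f := fun q =>
      (AddMonoidAlgebra.single q (f.coeff q) : Laurent p)) hTS
    rw [sum_single_coeff] at hsplit
    rcases (f.coeff.support \ T).eq_empty_or_nonempty with h | ⟨e, he⟩
    · refine ⟨A, 0, hA, .inl rfl, ?_⟩
      rw [h, Finset.sum_empty, zero_add] at hsplit
      rw [hsplit, AddMonoidAlgebra.single_zero, add_zero]
    · have h : f.coeff.support \ T = {e} :=
        Finset.eq_singleton_iff_unique_mem.mpr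
          ⟨he, fun x hx => Finset.card_le_one.mp hle x hx e he⟩
      rw [h, Finset.sum_singleton, add_comm] at hsplit
      exact ⟨e, f.coeff e, (Finset.mem_sdiff.mp he).1, .inr (Finset.mem_sdiff.mp he).2, hsplit⟩
  rw [hT, Finset.sum_insert n1, Finset.sum_insert n2, Finset.sum_insert n3,
    Finset.sum_singleton] at hsum
  have hbe := hbd e he
  have ha : f.coeff A ≠ 0 := Finsupp.mem_support_iff.mp hA
  obtain ⟨hb, hc, hd, -, r, hmr, hnr, hk, hl⟩ := rectangle_relation hpl hm hn (k := e.1 - A.1)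
    (l := e.2 - A.2) hbe.1 hbe.2.1 hbe.2.2.1 hbe.2.2.2 (a := f.coeff A)
    (b := f.coeff (A + ((m : ℤ), (m : ℤ))) * (-1) ^ m)
    (c := f.coeff (A + ((n : ℤ), -(n : ℤ))) * (-1) ^ n)
    (d := f.coeff (A + ((m : ℤ) + n, (m : ℤ) - n)) * ((-1) ^ m * (-1) ^ n)) (e := ε) ha
    (hεT.imp_right fun h hcon => h (by
      simp only [hT, Finset.mem_insert, Finset.mem_singleton, Prod.ext_iff, Prod.fst_add,
        Prod.snd_add]
      omega))
    (fun X Y h => by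
      have h0 : evalAt p h.1 h.2 f = 0 := by rw [evalAt_apply, sum_eq_zero_of_dvd hf h]
      rw [← hsum] at h0
      simp only [map_add, evalAt_single, Prod.fst_add, Prod.snd_add, ← sub_eq_add_neg] at h0
      rw [monomial_add_diag h.1 h.2, monomial_add_antidiag h.1 h.2,
        monomial_add_corner h.1 h.2] at h0
      have hne : X ^ A.1 * Y ^ A.2 ≠ 0 := mul_ne_zero (zpow_ne_zero _ h.1) (zpow_ne_zero _ h.2)
      apply mul_left_cancel₀ hne
      have he' : X ^ e.1 * Y ^ e.2 = X ^ A.1 * Y ^ A.2 * (X ^ (e.1 - A.1) * Y ^ (e.2 - A.2)) := by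
        rw [mul_mul_mul_comm, ← zpow_add₀ h.1, ← zpow_add₀ h.2, add_sub_cancel, add_sub_cancel]
      rw [he'] at h0
      simp only [zpow_natCast] at h0
      simp only [map_mul, map_pow, map_neg, map_one]
      linear_combination h0)
  -- the signs disappear: `-1` is fixed by Frobenius, also when `p = 2`
  have hneg : (-1 : ZMod p) ^ p ^ r = -1 := ZMod.pow_card_pow _
  rw [hmr, hneg] at hb
  rw [hnr, hneg] at hc
  rw [hmr, hnr, hneg] at hd
  rw [hmr, hnr] at hsum
  have hb' : f.coeff (A + (((p ^ r : ℕ) : ℤ), ((p ^ r : ℕ) : ℤ))) = f.coeff A := by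
    linear_combination -hb
  have hc' : f.coeff (A + (((p ^ r : ℕ) : ℤ), -((p ^ r : ℕ) : ℤ))) = f.coeff A := by
    linear_combination -hc
  have hd' : f.coeff (A + (((p ^ r : ℕ) : ℤ) + ((p ^ r : ℕ) : ℤ),
      ((p ^ r : ℕ) : ℤ) - ((p ^ r : ℕ) : ℤ))) = f.coeff A := by
    linear_combination hd
  obtain rfl : e = A + (((p ^ r : ℕ) : ℤ), 0) := by
    ext
    · simp only [Prod.fst_add]; omega
    · simp only [Prod.snd_add]; omega
  rw [hb', hc', hd'] at hsum
  have hfin : f = AddMonoidAlgebra.single (A + (((p ^ r : ℕ) : ℤ), 0)) (f.coeff A) * g p ^ p ^ r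
      + AddMonoidAlgebra.single (A + (((p ^ r : ℕ) : ℤ), 0)) (ε - f.coeff A) := by
    nth_rw 1 [← hsum]
    rw [g_pow_prime_pow]
    generalize ((p ^ r : ℕ) : ℤ) = q
    have p1 : A + (q, 0) + (q, 0) = A + (q + q, q - q) := by simp [add_assoc]
    have p2 : A + (q, 0) + (0, q) = A + (q, q) := by simp [add_assoc]
    have p3 : A + (q, 0) + (0, 0) = A + (q, 0) := by simp [add_assoc]
    have p4 : A + (q, 0) + (-q, 0) = A := by simp [add_assoc]
    have p5 : A + (q, 0) + (0, -q) = A + (q, -q) := by simp [add_assoc]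
    simp only [mul_add, AddMonoidAlgebra.single_mul_single, mul_one, p1, p2, p3, p4, p5,
      AddMonoidAlgebra.single_sub]
    abel
  have hε : ε - f.coeff A = 0 := by
    have hX := hpl.onCurve.left_ne_zero
    have hY := hpl.onCurve.right_ne_zero
    have h0 : evalAt p hX hY f = 0 := by
      rw [evalAt_apply, sum_eq_zero_of_dvd hf hpl.onCurve]
    rw [hfin, map_add, map_mul, map_pow, evalAt_g hpl.onCurve,
      zero_pow (pow_pos (Fact.out : p.Prime).pos r).ne', mul_zero, zero_add, evalAt_single] at h0
    exact (map_eq_zero _).mp ((mul_eq_zero.mp h0).resolve_right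
      (mul_ne_zero (zpow_ne_zero _ hX) (zpow_ne_zero _ hY)))
  rw [hε, AddMonoidAlgebra.single_zero, add_zero] at hfin
  exact ⟨r, f.coeff A, _, ha, hfin⟩

theorem card_support_single_mul_g_pow (u : Square) {a : ZMod p} (ha : a ≠ 0) (r : ℕ) :
    (AddMonoidAlgebra.single u a * g p ^ p ^ r : Laurent p).coeff.support.card = 5 := by
  have hq : ((p ^ r : ℕ) : ℤ) ≠ 0 := by
    exact_mod_cast (pow_pos (Fact.out : p.Prime).pos r).ne'
  rw [g_pow_prime_pow]
  generalize ((p ^ r : ℕ) : ℤ) = q at *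
  have h : (AddMonoidAlgebra.single u a * (AddMonoidAlgebra.single (q, 0) 1
      + AddMonoidAlgebra.single (0, q) 1 + AddMonoidAlgebra.single (0, 0) 1
      + AddMonoidAlgebra.single (-q, 0) 1 + AddMonoidAlgebra.single (0, -q) 1) :
      Laurent p).coeff.support =
      {u + (q, 0), u + (0, q), u + (0, 0), u + (-q, 0), u + (0, -q)} := by
    ext w
    simp only [mul_add, AddMonoidAlgebra.single_mul_single, mul_one, AddMonoidAlgebra.coeff_add,
      Finsupp.mem_support_iff, Finsupp.add_apply, AddMonoidAlgebra.coeff_single,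
      Finsupp.single_apply, Finset.mem_insert, Finset.mem_singleton, Prod.ext_iff, Prod.fst_add,
      Prod.snd_add]
    split_ifs <;> simp [ha] <;> omega
  rw [h]
  repeat rw [Finset.card_insert_of_notMem (by
    simp only [Finset.mem_insert, Finset.mem_singleton, Prod.ext_iff, Prod.fst_add, Prod.snd_add]
    omega)]
  rw [Finset.card_singleton]

/-- A nonzero multiple of `g` with at most five terms is a monomial times `g ^ p ^ r`. -/
theorem exists_eq_of_card_support_le {f : Laurent p} (hf : g p ∣ f) (hf0 : f ≠ 0)
    (hcard : f.coeff.support.card ≤ 5) :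
    ∃ (r : ℕ) (a : ZMod p) (u : Square), a ≠ 0 ∧
      f = AddMonoidAlgebra.single u a * g p ^ p ^ r := by
  obtain ⟨X, Y, hpl⟩ := exists_isPlace p
  have hne : f.coeff.support.Nonempty := by
    rw [Finsupp.support_nonempty_iff]
    simpa using hf0
  refine exists_eq_of_hasRectangle hf hcard ((hasRectangle_or_hasPentagon hcard hne ?_).resolve_right
    (not_hasPentagon hf hcard))
  have hv := hpl.trivialOn
  have hX := hpl.ord_left
  have hY := hpl.ord_right
  have hX' := ord_inv hX
  have hY' := ord_inv hY
  rw [neg_neg] at hY'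
  have hon := hpl.onCurve
  rintro α β (rfl | rfl) (rfl | rfl) q hq hmin
  · exact exists_ne_of_sum_eq_zero hv hX hY' _ (sum_eq_zero_of_dvd hf hon.inv_right) hq hmin
  · exact exists_ne_of_sum_eq_zero hv hX hY _ (sum_eq_zero_of_dvd hf hon) hq hmin
  · exact exists_ne_of_sum_eq_zero hv hX' hY' _ (sum_eq_zero_of_dvd hf hon.inv_left.inv_right) hq
      hmin
  · exact exists_ne_of_sum_eq_zero hv hX' hY _ (sum_eq_zero_of_dvd hf hon.inv_left) hq hmin

end Classification

end LightsOut

theorem mainTheorem1 (p : ℕ) (hp : p.Prime) (c : LightsOut.Clicks p) (hc : c ≠ 0) :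
    (LightsOut.lit c).Finite ∧
    5 ≤ (LightsOut.lit c).ncard ∧
    ((LightsOut.lit c).ncard = 5 ↔
      ∃ (n : ℕ) (k₀ : ZMod p) (v : LightsOut.Square), k₀ ≠ 0 ∧
        ∀ q : LightsOut.Square, c q = LightsOut.evoPattern p n k₀ (q - v)) := by
  have : Fact p.Prime := ⟨hp⟩
  rw [LightsOut.lit_eq_support, Set.ncard_coe_finset]
  simp only [LightsOut.translate_iff]
  have hc' : (AddMonoidAlgebra.ofCoeff c : LightsOut.Laurent p) ≠ 0 := by
    simpa [← AddMonoidAlgebra.coeff_inj] using hc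
  have hf0 := mul_ne_zero hc' (LightsOut.g_ne_zero (p := p))
  have key := LightsOut.exists_eq_of_card_support_le (Dvd.intro_left _ rfl) hf0
  refine ⟨Finset.finite_toSet _, ?_, fun h => key h.le, ?_⟩
  · by_contra! hlt
    obtain ⟨r, a, u, ha, hr⟩ := key (by omega)
    rw [hr, LightsOut.card_support_single_mul_g_pow u ha r] at hlt
    omega
  · rintro ⟨r, a, u, ha, hr⟩
    rw [hr, LightsOut.card_support_single_mul_g_pow u ha r]
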